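/- Let $M^n$ be a smooth Riemannian manifold and let $f\colon M^n\to\mathbb{R}^{n+p}$ be a smooth isometric immersion, with normal spaces $N_fM(x)=(f_*T_xM)^\perp$ and second fundamental form $\alpha\colon T_xM\times T_xM\to N_fM(x)$. For $\xi\in N_fM(x)$ let $A_\xi\colon T_xM\to T_xM$ be the shape operator, $\langle A_\xi X,Y\rangle=\langle\alpha(X,Y),\xi\rangle$. Let $L^l$ be a connected (nonempty, possibly only immersed) totally geodesic submanifold of $M^n$, that is, one whose second fundamental form in $M^n$ (with respect to the Levi-Civita connection of $M^n$) vanishes. Suppose that $\alpha$ is adapted to $(TL,\,TL^\perp\cap TM)$: at every point $x$ of $L$, both $T_xL$ and its orthogonal complement in $T_xM$ are preserved by $A_\xi$ for all $\xi\in N_fM(x)$. Then $f|_L$ admits a reduction of codimension to $p$: there is a totally geodesic submanifold of $\mathbb{R}^{n+p}$, i.e. an affine subspace, of dimension $l+p$ that contains $f(L)$. -/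

import Mathlib

open Bundle Manifold VectorField
open scoped ContDiff Manifold Topology InnerProductSpace


noncomputable section

/-! ### Symmetric bilinear forms, shape operators, adapted decompositions -/

section Algebra

variable {V W : Type*} [NormedAddCommGroup V] [InnerProductSpace ℝ V] [FiniteDimensional ℝ V]
  [NormedAddCommGroup W] [InnerProductSpace ℝ W]

/-- The endomorphism `A` of `V` with `⟪A X, Y⟫ = B (X, Y)`. -/
def rieszEnd (B : V →L[ℝ] V →L[ℝ] ℝ) : V →L[ℝ] V :=
  LinearMap.toContinuousLinearMap
    { toFun := fun X ↦ (InnerProductSpace.toDual ℝ V).symm (B X)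
      map_add' := by simp
      map_smul' := by simp }

@[simp]
theorem inner_rieszEnd (B : V →L[ℝ] V →L[ℝ] ℝ) (X Y : V) : ⟪rieszEnd B X, Y⟫_ℝ = B X Y := by
  simp [rieszEnd]

/-- The shape operator `A_ξ : V → V` of a bilinear form `α : V × V → W` with respect to `ξ : W`,
i.e. the linear map with `⟪A_ξ X, Y⟫ = ⟪α (X, Y), ξ⟫`. -/
def shapeOperator (α : V →L[ℝ] V →L[ℝ] W) (ξ : W) : V →L[ℝ] V :=
  rieszEnd ((ContinuousLinearMap.compL ℝ V W ℝ (innerSL ℝ ξ)) ∘L α)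

theorem inner_shapeOperator (α : V →L[ℝ] V →L[ℝ] W) (ξ : W) (X Y : V) :
    ⟪shapeOperator α ξ X, Y⟫_ℝ = ⟪α X Y, ξ⟫_ℝ := by
  rw [shapeOperator, inner_rieszEnd, real_inner_comm]
  simp

/-- `α` is adapted to the family `E` of subspaces (in practice, an orthogonal decomposition of `V`):
every member of the family is preserved by all shape operators of `α`. -/
def IsAdapted {κ : Type*} (α : V →L[ℝ] V →L[ℝ] W) (E : κ → Submodule ℝ V) : Prop :=
  ∀ (i : κ) (ξ : W), ∀ X ∈ E i, shapeOperator α ξ X ∈ E i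

end Algebra

/-! ### The Levi-Civita connection of a Riemannian manifold -/

section LeviCivita

variable {E : Type*} [NormedAddCommGroup E] [NormedSpace ℝ E] [FiniteDimensional ℝ E]
  {H : Type*} [TopologicalSpace H] {I : ModelWithCorners ℝ E H}
  {M : Type*} [TopologicalSpace M] [ChartedSpace H M]

instance instFiniteDimensionalTangentSpace (x : M) : FiniteDimensional ℝ (TangentSpace I x) :=
  inferInstanceAs (FiniteDimensional ℝ E)

variable [RiemannianBundle (fun x : M ↦ TangentSpace I x)]

variable (I) in
/-- The right-hand side of the Koszul formula for `2 ⟪∇_X Y, Z⟫`, at the point `x`. -/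
def koszul (X Y Z : Π x : M, TangentSpace I x) (x : M) : ℝ :=
  d% (fun x' ↦ ⟪Y x', Z x'⟫_ℝ) x (X x) + d% (fun x' ↦ ⟪X x', Z x'⟫_ℝ) x (Y x)
    - d% (fun x' ↦ ⟪X x', Y x'⟫_ℝ) x (Z x)
    + ⟪mlieBracket I X Y x, Z x⟫_ℝ - ⟪mlieBracket I X Z x, Y x⟫_ℝ - ⟪mlieBracket I Y Z x, X x⟫_ℝ

theorem mdiffAt_inner [IsManifold I 1 M]
    [IsContMDiffRiemannianBundle I 1 E (fun x : M ↦ TangentSpace I x)]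
    {Y Z : Π x : M, TangentSpace I x} {x : M} (hY : MDiffAt (T% Y) x) (hZ : MDiffAt (T% Z) x) :
    MDiffAt (fun x' ↦ ⟪Y x', Z x'⟫_ℝ) x :=
  MDifferentiableAt.inner_bundle (F := E) (E := fun x : M ↦ TangentSpace I x) (b := id) hY hZ

variable [IsManifold I ∞ M] [IsContMDiffRiemannianBundle I ∞ E (fun x : M ↦ TangentSpace I x)]

theorem koszul_tensorial_left {Y Z : Π x : M, TangentSpace I x} {x : M}
    (hY : MDiffAt (T% Y) x) (hZ : MDiffAt (T% Z) x) :
    TensorialAt I E (fun X ↦ koszul I X Y Z x) x where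
  smul {g X} hg hX := by
    have h1 := mvfderiv_fun_mul hg (mdiffAt_inner hX hZ)
    have h2 := mvfderiv_fun_mul hg (mdiffAt_inner hX hY)
    simp only [koszul, Pi.smul_apply', real_inner_smul_left, h1, h2,
      mlieBracket_smul_left hg hX, inner_add_left, inner_smul_right, add_apply, smul_apply,
      map_smul, smul_eq_mul, real_inner_comm (Y x) (X x)]
    ring
  add hX hX' := by
    simp [koszul, inner_add_left, inner_add_right,
      mvfderiv_fun_add (mdiffAt_inner hX hZ) (mdiffAt_inner hX' hZ),
      mvfderiv_fun_add (mdiffAt_inner hX hY) (mdiffAt_inner hX' hY), mlieBracket_add_left hX hX']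
    ring

theorem koszul_tensorial_right {X Y : Π x : M, TangentSpace I x} {x : M}
    (hX : MDiffAt (T% X) x) (hY : MDiffAt (T% Y) x) :
    TensorialAt I E (fun Z ↦ koszul I X Y Z x) x where
  smul {g Z} hg hZ := by
    have h1 := mvfderiv_fun_mul hg (mdiffAt_inner hX hZ)
    have h2 := mvfderiv_fun_mul hg (mdiffAt_inner hY hZ)
    simp only [koszul, Pi.smul_apply', real_inner_smul_left, h1, h2,
      mlieBracket_smul_right hg hZ, inner_add_left, inner_smul_right, add_apply, smul_apply,
      map_smul, smul_eq_mul, real_inner_comm (Z x)]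
    ring
  add hZ hZ' := by
    simp [koszul, inner_add_left, inner_add_right,
      mvfderiv_fun_add (mdiffAt_inner hX hZ) (mdiffAt_inner hX hZ'),
      mvfderiv_fun_add (mdiffAt_inner hY hZ) (mdiffAt_inner hY hZ'), mlieBracket_add_right hZ hZ']
    ring

open Classical in
/-- The Levi-Civita connection as an operator: if the vector field `Y` is differentiable at `x`,
`leviCivitaAux Y x v` is the vector `∇_v Y` determined by the Koszul formula. -/
def leviCivitaAux (Y : Π x : M, TangentSpace I x) (x : M) :
    TangentSpace I x →L[ℝ] TangentSpace I x :=
  if hY : MDiffAt (T% Y) x then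
    (1 / 2 : ℝ) •
      rieszEnd (TensorialAt.mkHom₂ (F := E) (F' := E) (fun X Z ↦ koszul I X Y Z x) x
        (fun _ hZ ↦ koszul_tensorial_left hY hZ) (fun _ hX ↦ koszul_tensorial_right hX hY))
  else 0

theorem inner_leviCivitaAux {X Y Z : Π x : M, TangentSpace I x} {x : M}
    (hX : MDiffAt (T% X) x) (hY : MDiffAt (T% Y) x) (hZ : MDiffAt (T% Z) x) :
    ⟪leviCivitaAux Y x (X x), Z x⟫_ℝ = koszul I X Y Z x / 2 := by
  have := TensorialAt.mkHom₂_apply (F := E) (F' := E) (Φ := fun X Z ↦ koszul I X Y Z x)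
    (fun _ hZ ↦ koszul_tensorial_left hY hZ) (fun _ hX ↦ koszul_tensorial_right hX hY) hX hZ
  rw [leviCivitaAux, dif_pos hY, ← this]
  simp [inner_smul_left]
  ring

theorem leviCivitaAux_eq {Y : Π x : M, TangentSpace I x} {x : M}
    (hY : MDiffAt (T% Y) x) {B : TangentSpace I x →L[ℝ] TangentSpace I x}
    (h : ∀ X Z : Π x : M, TangentSpace I x, MDiffAt (T% X) x → MDiffAt (T% Z) x →
      ⟪B (X x), Z x⟫_ℝ = koszul I X Y Z x / 2) : leviCivitaAux Y x = B := by
  ext1 v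
  refine ext_inner_right ℝ fun w ↦ ?_
  have hv := FiberBundle.mdifferentiableAt_extend I E (V := fun x : M ↦ TangentSpace I x) v
  have hw := FiberBundle.mdifferentiableAt_extend I E (V := fun x : M ↦ TangentSpace I x) w
  have h1 := inner_leviCivitaAux hv hY hw
  rw [← h _ _ hv hw] at h1
  simpa using h1

variable (I M) in
/-- The Levi-Civita connection of a Riemannian manifold. -/
def leviCivita : CovariantDerivative I E (fun x : M ↦ TangentSpace I x) where
  toFun := leviCivitaAux
  isCovariantDerivativeOnUniv :=
    { add := by
        intro Y Y' x hY hY' _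
        refine leviCivitaAux_eq (mdifferentiableAt_add_section hY hY') fun X Z hX hZ ↦ ?_
        simp [inner_add_left, inner_leviCivitaAux hX hY hZ, inner_leviCivitaAux hX hY' hZ]
        simp [koszul, inner_add_left, inner_add_right,
          mvfderiv_fun_add (mdiffAt_inner hX hY) (mdiffAt_inner hX hY'),
          mvfderiv_fun_add (mdiffAt_inner hY hZ) (mdiffAt_inner hY' hZ),
          mlieBracket_add_right hY hY', mlieBracket_add_left hY hY']
        ring
      leibniz := by
        intro Y g x hY hg _
        refine leviCivitaAux_eq (hg.smul_section hY) fun X Z hX hZ ↦ ?_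
        simp [inner_add_left, inner_smul_left, inner_leviCivitaAux hX hY hZ]
        have h1 := mvfderiv_fun_mul hg (mdiffAt_inner hX hY)
        have h2 := mvfderiv_fun_mul hg (mdiffAt_inner hY hZ)
        simp only [koszul, Pi.smul_apply', real_inner_smul_left, h1, h2,
          mlieBracket_smul_right hg hY, mlieBracket_smul_left hg hY, inner_add_left,
          inner_smul_right, add_apply, smul_apply,
          map_smul, smul_eq_mul, real_inner_comm (X x) (Y x)]
        ring }

theorem inner_leviCivita {X Y Z : Π x : M, TangentSpace I x} {x : M}
    (hX : MDiffAt (T% X) x) (hY : MDiffAt (T% Y) x) (hZ : MDiffAt (T% Z) x) :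
    ⟪leviCivita I M Y x (X x), Z x⟫_ℝ = koszul I X Y Z x / 2 :=
  inner_leviCivitaAux hX hY hZ

variable (I M) in
theorem leviCivita_torsion : (leviCivita I M).torsion = 0 := by
  rw [CovariantDerivative.torsion_eq_zero_iff]
  intro X Y x hX hY
  refine ext_inner_right ℝ fun w ↦ ?_
  have hw := FiberBundle.mdifferentiableAt_extend I E (V := fun x : M ↦ TangentSpace I x) w
  have h1 := inner_leviCivita hX hY hw
  have h2 := inner_leviCivita hY hX hw
  rw [FiberBundle.extend_apply_self] at h1 h2
  rw [inner_sub_left, h1, h2]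
  simp only [koszul, FiberBundle.extend_apply_self, real_inner_comm (Y _) (X _),
    mlieBracket_swap_apply (V := Y) (W := X), inner_neg_left]
  ring

theorem leviCivita_metric {X Y Z : Π x : M, TangentSpace I x} {x : M}
    (hX : MDiffAt (T% X) x) (hY : MDiffAt (T% Y) x) (hZ : MDiffAt (T% Z) x) :
    d% (fun x' ↦ ⟪Y x', Z x'⟫_ℝ) x (X x) =
      ⟪leviCivita I M Y x (X x), Z x⟫_ℝ + ⟪Y x, leviCivita I M Z x (X x)⟫_ℝ := by
  rw [inner_leviCivita hX hY hZ, real_inner_comm, inner_leviCivita hX hZ hY]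
  simp only [koszul, real_inner_comm (Y _) (X _), real_inner_comm (Z _) (X _),
    real_inner_comm (Z _) (Y _),
    mlieBracket_swap_apply (V := Z) (W := Y), inner_neg_left]
  ring

end LeviCivita

/-! ### Isometric immersions into a Euclidean space -/

section Immersion

variable {E : Type*} [NormedAddCommGroup E] [NormedSpace ℝ E] [FiniteDimensional ℝ E]
  {H : Type*} [TopologicalSpace H] {I : ModelWithCorners ℝ E H}
  {M : Type*} [TopologicalSpace M] [ChartedSpace H M]
  {F : Type*} [NormedAddCommGroup F] [InnerProductSpace ℝ F] [FiniteDimensional ℝ F]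

variable (I) in
/-- The normal space `N_f M (x)`, the orthogonal complement of `f_* T_x M`. -/
def normalSpace (f : M → F) (x : M) : Submodule ℝ F := (LinearMap.range (d% f x).toLinearMap)ᗮ

variable [IsManifold I ∞ M]

theorem mdiffAt_pushforward {f : M → F} (hf : ContMDiff I 𝓘(ℝ, F) ∞ f)
    {Y : Π x : M, TangentSpace I x} {x : M} (hY : MDiffAt (T% Y) x) :
    MDiffAt (fun x' ↦ d% f x' (Y x')) x := by
  have h1 : ContMDiff I.tangent 𝓘(ℝ, F).tangent 1 (tangentMap I 𝓘(ℝ, F) f) :=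
    hf.contMDiff_tangentMap (by norm_cast)
  have h2 := (contMDiff_snd_tangentBundle_modelSpace F 𝓘(ℝ, F) (n := 1)).comp h1
  exact (h2.mdifferentiable one_ne_zero _).comp x hY

/-- The normal component at `x` of the derivative of `f_* Y` in the direction `X`; by the Gauss
formula this is the second fundamental form of `f` applied to the vector fields `X` and `Y`. -/
def gaussNormal (f : M → F) (X Y : Π x : M, TangentSpace I x) (x : M) : normalSpace I f x :=
  (normalSpace I f x).orthogonalProjectionOnto (d% (fun x' ↦ d% f x' (Y x')) x (X x))

theorem gaussNormal_tensorial_left (f : M → F) (Y : Π x : M, TangentSpace I x) (x : M) :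
    TensorialAt I E (fun X ↦ gaussNormal f X Y x) x where
  smul _ _ := by simp [gaussNormal]
  add _ _ := by simp [gaussNormal]

theorem gaussNormal_tensorial_right {f : M → F}
    (hf : ContMDiff I 𝓘(ℝ, F) ∞ f) (X : Π x : M, TangentSpace I x) (x : M) :
    TensorialAt I E (fun Y ↦ gaussNormal f X Y x) x where
  smul {g Y} hg hY := by
    have h1 := mvfderiv_smul hg (mdiffAt_pushforward hf hY)
    have h2 : (normalSpace I f x).orthogonalProjectionOnto (d% f x (Y x)) = 0 := by
      rw [Submodule.orthogonalProjectionOnto_eq_zero_iff]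
      exact Submodule.le_orthogonal_orthogonal _ (LinearMap.mem_range_self _ _)
    have h3 : (fun x' ↦ d% f x' ((g • Y) x')) = g • fun x' ↦ d% f x' (Y x') := by
      ext x'; simp
    rw [gaussNormal, h3, h1]
    simp [gaussNormal, h2]
  add {Y Y'} hY hY' := by
    have h1 := mvfderiv_add (mdiffAt_pushforward hf hY) (mdiffAt_pushforward hf hY')
    have h3 : (fun x' ↦ d% f x' ((Y + Y') x')) =
        (fun x' ↦ d% f x' (Y x')) + fun x' ↦ d% f x' (Y' x') := by
      ext x'; simp
    rw [gaussNormal, h3, h1]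
    simp [gaussNormal]

/-- The second fundamental form `α_x : T_x M × T_x M → N_f M (x)` of a smooth `f : M → F`. -/
def secondFundamentalForm (f : M → F) (hf : ContMDiff I 𝓘(ℝ, F) ∞ f) (x : M) :
    TangentSpace I x →L[ℝ] TangentSpace I x →L[ℝ] normalSpace I f x :=
  TensorialAt.mkHom₂ (F := E) (F' := E) (fun X Y ↦ gaussNormal f X Y x) x
    (fun _ _ ↦ gaussNormal_tensorial_left f _ x) (fun _ _ ↦ gaussNormal_tensorial_right hf _ x)

theorem secondFundamentalForm_apply {f : M → F}
    (hf : ContMDiff I 𝓘(ℝ, F) ∞ f) {X Y : Π x : M, TangentSpace I x} {x : M}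
    (hX : MDiffAt (T% X) x) (hY : MDiffAt (T% Y) x) :
    secondFundamentalForm f hf x (X x) (Y x) =
      (normalSpace I f x).orthogonalProjectionOnto (d% (fun x' ↦ d% f x' (Y x')) x (X x)) :=
  TensorialAt.mkHom₂_apply (F := E) (F' := E) (Φ := fun X Y ↦ gaussNormal f X Y x)
    (fun _ _ ↦ gaussNormal_tensorial_left f _ x) (fun _ _ ↦ gaussNormal_tensorial_right hf _ x)
    hX hY

variable (I) in
/-- `f : M → F` is a (smooth) isometric immersion of the Riemannian manifold `M`. -/
structure IsIsometricImmersion [RiemannianBundle (fun x : M ↦ TangentSpace I x)]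
    (f : M → F) : Prop where
  contMDiff : ContMDiff I 𝓘(ℝ, F) ∞ f
  inner_eq (x : M) (v w : TangentSpace I x) : ⟪d% f x v, d% f x w⟫_ℝ = ⟪v, w⟫_ℝ

/-- A map `g : L → F` from an `l`-dimensional manifold admits a reduction of codimension to `q`: its
image lies in a totally geodesic submanifold of `F` (that is, an affine subspace) of dimension
`l + q`. -/
def AdmitsReductionOfCodimension {L : Type*} (l : ℕ) (g : L → F) (q : ℕ) : Prop :=
  ∃ S : AffineSubspace ℝ F, (S : Set F).Nonempty ∧
    Module.finrank ℝ S.direction = l + q ∧ ∀ y : L, g y ∈ S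

end Immersion

/-! ### Totally geodesic submanifolds -/

section TotallyGeodesic

variable {E : Type*} [NormedAddCommGroup E] [NormedSpace ℝ E] [FiniteDimensional ℝ E]
  {H : Type*} [TopologicalSpace H] {I : ModelWithCorners ℝ E H}
  {M : Type*} [TopologicalSpace M] [ChartedSpace H M]
  {E' : Type*} [NormedAddCommGroup E'] [NormedSpace ℝ E']
  {H' : Type*} [TopologicalSpace H'] {J : ModelWithCorners ℝ E' H'}
  {L : Type*} [TopologicalSpace L] [ChartedSpace H' L]

variable (I J) in
/-- The tangent space at `y` of the submanifold `ι : L → M`, as a subspace of `T_{ι y} M`. -/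
def tangentSubspace (ι : L → M) (y : L) : Submodule ℝ (TangentSpace I (ι y)) :=
  LinearMap.range (mfderiv J I ι y).toLinearMap

variable (I J) in
/-- The immersed submanifold `ι : L → M` of the Riemannian manifold `M` is totally geodesic: its
second fundamental form in `M` vanishes, i.e. `∇_X Y` is tangent to `L` whenever `X` and `Y` are.
Here `Y` is a smooth vector field on an open subset of `M` that is tangent to `L` along a
neighbourhood of `y` in `L`, and `v` is the value of `X` at `y`. -/
def IsTotallyGeodesic [IsManifold I ∞ M] [RiemannianBundle (fun x : M ↦ TangentSpace I x)]
    [IsContMDiffRiemannianBundle I ∞ E (fun x : M ↦ TangentSpace I x)] (ι : L → M) : Prop :=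
  ∀ (y : L) (Y : Π x : M, TangentSpace I x),
    (∀ᶠ x in 𝓝 (ι y), ContMDiffAt I I.tangent ∞ (T% Y) x) →
    (∀ᶠ y' in 𝓝 y, Y (ι y') ∈ tangentSubspace I J ι y') →
    ∀ v ∈ tangentSubspace I J ι y, leviCivita I M Y (ι y) v ∈ tangentSubspace I J ι y

end TotallyGeodesic

end

/-!
Along `L` consider the subspace `C y = f_* (T_y L^⊥ ∩ T M)` of `F`. The derivative of the orthogonal
projection onto `f_* T M` is the second fundamental form of `f`, and likewise for `f ∘ ι`, whose
second fundamental form is the restriction of that of `f` because `L` is totally geodesic. Hence the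
derivative of the projection onto `C`, the difference of these two projections, is the mixed part of
the second fundamental form of `f`, which vanishes because `α` is adapted. So `C` is constant along
the connected manifold `L`, and so is its orthogonal complement `f_* T L ⊕ N_f M`, of dimension
`l + p`, which contains all tangent spaces of `f ∘ ι`.
-/

noncomputable section

section Calculus

variable {𝕜 : Type*} [NontriviallyNormedField 𝕜]
  {E : Type*} [NormedAddCommGroup E] [NormedSpace 𝕜 E]
  {H : Type*} [TopologicalSpace H] {I : ModelWithCorners 𝕜 E H}
  {M : Type*} [TopologicalSpace M] [ChartedSpace H M]
  {G : Type*} [NormedAddCommGroup G] [NormedSpace 𝕜 G]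
  {G₁ : Type*} [NormedAddCommGroup G₁] [NormedSpace 𝕜 G₁]
  {G₂ : Type*} [NormedAddCommGroup G₂] [NormedSpace 𝕜 G₂]

theorem mvfderiv_congr_of_eventuallyEq {g g' : M → G} {x : M} (h : g =ᶠ[𝓝 x] g') :
    d% g x = d% g' x := by
  ext v
  exact congr($(h.mfderiv_eq (I := I) (I' := 𝓘(𝕜, G))) v)

section Comp

variable {E' : Type*} [NormedAddCommGroup E'] [NormedSpace 𝕜 E']
  {H' : Type*} [TopologicalSpace H'] {J : ModelWithCorners 𝕜 E' H'}
  {L : Type*} [TopologicalSpace L] [ChartedSpace H' L] {g : M → G} {ι : L → M} {y : L}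

theorem mvfderiv_comp_mfderiv_apply (hg : MDiffAt g (ι y)) (hι : MDiffAt ι y)
    (v : TangentSpace J y) : d% (g ∘ ι) y v = d% g (ι y) (mfderiv J I ι y v) :=
  congr($(mfderiv_comp y hg hι) v)

theorem range_mvfderiv_comp_le (hg : MDiffAt g (ι y)) (hι : MDiffAt ι y) :
    (d% (g ∘ ι) y).range ≤ (d% g (ι y)).range := by
  rintro _ ⟨v, rfl⟩
  exact ⟨mfderiv J I ι y v, (mvfderiv_comp_mfderiv_apply hg hι v).symm⟩

theorem injective_mvfderiv_comp (hg : MDiffAt g (ι y)) (hι : MDiffAt ι y)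
    (hginj : Function.Injective (d% g (ι y))) (hιinj : Function.Injective (mfderiv J I ι y)) :
    Function.Injective (d% (g ∘ ι) y) := by
  intro v v' h
  rw [mvfderiv_comp_mfderiv_apply hg hι, mvfderiv_comp_mfderiv_apply hg hι] at h
  exact hιinj (hginj h)

end Comp

theorem mvfderiv_comp_fderiv_apply {g : G → G₁} {p : M → G} {x : M}
    (hg : DifferentiableAt 𝕜 g (p x)) (hp : MDiffAt p x) (v : TangentSpace I x) :
    d% (g ∘ p) x v = fderiv 𝕜 g (p x) (d% p x v) := by
  rw [mvfderiv_comp_mfderiv_apply hg.mdifferentiableAt hp, mvfderiv, mfderiv_eq_fderiv]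
  rfl

theorem mvfderiv_clm_apply_apply (B : G →L[𝕜] G₁) {p : M → G} {x : M} (hp : MDiffAt p x)
    (v : TangentSpace I x) : d% (fun x' ↦ B (p x')) x v = B (d% p x v) := by
  have h := mvfderiv_comp_fderiv_apply B.differentiableAt hp v
  rwa [B.fderiv] at h

theorem mvfderiv_bilinear_apply (B : G →L[𝕜] G₁ →L[𝕜] G₂) {p : M → G} {q : M → G₁} {x : M}
    (hp : MDiffAt p x) (hq : MDiffAt q x) (v : TangentSpace I x) :
    d% (fun x' ↦ B (p x') (q x')) x v = B (p x) (d% q x v) + B (d% p x v) (q x) := by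
  have hB := B.isBoundedBilinearMap
  have hpq := hp.prodMk_space hq
  have hfst := mvfderiv_clm_apply_apply (.fst 𝕜 G G₁) hpq v
  have hsnd := mvfderiv_clm_apply_apply (.snd 𝕜 G G₁) hpq v
  have h := mvfderiv_comp_fderiv_apply (p := fun x' ↦ (p x', q x')) (hB.differentiableAt _) hpq v
  rw [hB.fderiv] at h
  refine h.trans ?_
  rw [IsBoundedBilinearMap.deriv_apply]
  exact congr(B (p x) $hsnd.symm + B $hfst.symm (q x))

end Calculus

section Constancy

variable {E : Type*} [NormedAddCommGroup E] [NormedSpace ℝ E]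
  {H : Type*} [TopologicalSpace H] {I : ModelWithCorners ℝ E H}
  {M : Type*} [TopologicalSpace M] [ChartedSpace H M] [IsManifold I 1 M]
  {G : Type*} [NormedAddCommGroup G] [NormedSpace ℝ G]

theorem isLocallyConstant_of_mvfderiv_eq_zero {g : M → G} (hg : ∀ x, MDiffAt g x)
    (h0 : ∀ x, d% g x = 0) : IsLocallyConstant g := by
  refine IsLocallyConstant.iff_eventually_eq _ |>.mpr fun x ↦ ?_
  set φ := extChartAt I x
  obtain ⟨r, hr, hball⟩ := Metric.mem_nhdsWithin_iff.mp
    (extChartAt_target_mem_nhdsWithin (I := I) x)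
  have hderiv : ∀ z ∈ Metric.ball (φ x) r ∩ Set.range I,
      HasFDerivWithinAt (g ∘ φ.symm) (0 : E →L[ℝ] G) (Metric.ball (φ x) r ∩ Set.range I) z := by
    intro z hz
    have hφ := mdifferentiableWithinAt_extChartAt_symm (I := I) (hball hz)
    have h := (hg (φ.symm z)).hasMFDerivAt.comp_hasMFDerivWithinAt z hφ.hasMFDerivWithinAt
    have h' : mfderiv I 𝓘(ℝ, G) g (φ.symm z) = 0 := h0 _
    rw [h'] at h
    exact (hasMFDerivWithinAt_iff_hasFDerivWithinAt.mp h).mono Set.inter_subset_right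
  filter_upwards [extChartAt_source_mem_nhds (I := I) x,
    (continuousAt_extChartAt (I := I) x).preimage_mem_nhds (Metric.ball_mem_nhds _ hr)]
    with y hy hyr
  have hconvex := (convex_ball (φ x) r).inter I.convex_range
  have h := hconvex.norm_image_sub_le_of_norm_hasFDerivWithin_le
    (C := 0) hderiv (by simp) ⟨Metric.mem_ball_self hr, by simp [φ]⟩ ⟨hyr, by simp⟩
  simpa only [Function.comp_apply, φ, (extChartAt I x).left_inv hy, extChartAt_to_inv, zero_mul,
    norm_le_zero_iff, sub_eq_zero] using h

variable {F : Type*} [NormedAddCommGroup F] [InnerProductSpace ℝ F]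

theorem sub_mem_orthogonal_of_range_mvfderiv_le [PreconnectedSpace M] {S : Submodule ℝ F}
    [S.HasOrthogonalProjection] {g : M → F} (hg : ∀ x, MDiffAt g x)
    (hS : ∀ x, (d% g x).range ≤ Sᗮ) (x x₀ : M) : g x - g x₀ ∈ Sᗮ := by
  have hloc : IsLocallyConstant fun x ↦ S.starProjection (g x) := by
    refine isLocallyConstant_of_mvfderiv_eq_zero (I := I) (fun x ↦ ?_) fun x ↦ ?_
    · exact S.starProjection.differentiableAt.mdifferentiableAt.comp x (hg x)
    · ext v
      rw [mvfderiv_clm_apply_apply _ (hg x)]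
      exact S.starProjection_apply_eq_zero_iff.mpr (hS x ⟨v, rfl⟩)
  rw [← Submodule.starProjection_apply_eq_zero_iff, map_sub, sub_eq_zero]
  exact hloc.apply_eq_of_preconnectedSpace x x₀

end Constancy

section Projections

variable {E F : Type*} [NormedAddCommGroup E] [NormedSpace ℝ E] [FiniteDimensional ℝ E]
  [NormedAddCommGroup F] [InnerProductSpace ℝ F]

/-- The dual `F → E*`, `y ↦ ⟪A ·, y⟫` of a linear map `A : E → F`; it replaces the adjoint of `A`
when `E` carries no inner product. -/
def innerDual (A : E →L[ℝ] F) : F →L[ℝ] E →L[ℝ] ℝ :=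
  (innerSL ℝ ∘L A).flip

theorem isInvertible_innerDual_comp_self {A : E →L[ℝ] F} (hA : Function.Injective A) :
    (innerDual A ∘L A).IsInvertible := by
  have hinj : Function.Injective (innerDual A ∘L A).toLinearMap := by
    rw [injective_iff_map_eq_zero]
    intro v hv
    have h : ⟪A v, A v⟫_ℝ = 0 := congr($hv v)
    exact hA ((inner_self_eq_zero.mp h).trans (map_zero A).symm)
  have hdim : Module.finrank ℝ E = Module.finrank ℝ (E →L[ℝ] ℝ) :=
    (LinearMap.toContinuousLinearMap.finrank_eq.symm.trans Subspace.dual_finrank_eq).symm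
  exact ⟨(LinearEquiv.ofInjectiveOfFinrankEq _ hinj hdim).toContinuousLinearEquiv, by ext; rfl⟩

theorem starProjection_range_eq {A : E →L[ℝ] F} (hA : Function.Injective A) :
    A.range.starProjection = A ∘L (innerDual A ∘L A).inverse ∘L innerDual A := by
  ext1 y
  refine Submodule.eq_starProjection_of_mem_of_inner_eq_zero ⟨_, rfl⟩ ?_
  rintro _ ⟨u, rfl⟩
  have h := (isInvertible_innerDual_comp_self hA).self_apply_inverse (innerDual A y)
  rw [real_inner_comm, inner_sub_right, sub_eq_zero]
  exact congr($h.symm u)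

variable [FiniteDimensional ℝ F]

theorem contDiff_innerDual {n : ℕ∞ω} :
    ContDiff ℝ n (innerDual : (E →L[ℝ] F) → F →L[ℝ] E →L[ℝ] ℝ) :=
  contDiff_clm_apply_iff.mpr fun _ ↦ contDiff_clm_apply_iff.mpr fun _ ↦
    (contDiff_id.clm_apply contDiff_const).inner ℝ contDiff_const

set_option synthInstance.maxHeartbeats 80000 in
-- The search for the norm on `(E →L[ℝ] ℝ) →L[ℝ] E` exceeds the default limit.
theorem contDiffAt_starProjection_range {A : E →L[ℝ] F} (hA : Function.Injective A) {n : ℕ∞ω} :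
    ContDiffAt ℝ n (fun B : E →L[ℝ] F ↦ B.range.starProjection) A := by
  have hgram : ContDiff ℝ n (fun B : E →L[ℝ] F ↦ innerDual B ∘L B) :=
    contDiff_innerDual.clm_comp contDiff_id
  have hinv : ContDiffAt ℝ n (fun B : E →L[ℝ] F ↦ (innerDual B ∘L B).inverse) A :=
    .comp A (f := fun B : E →L[ℝ] F ↦ innerDual B ∘L B)
      (isInvertible_innerDual_comp_self hA).contDiffAt_map_inverse hgram.contDiffAt
  refine (contDiffAt_id.clm_comp
    (hinv.clm_comp contDiff_innerDual.contDiffAt)).congr_of_eventuallyEq ?_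
  filter_upwards [ContinuousLinearMap.isOpen_injective.mem_nhds hA] with B hB
  exact starProjection_range_eq hB

end Projections

section DerivStarProjection

variable {E : Type*} [NormedAddCommGroup E] [NormedSpace ℝ E]
  {H : Type*} [TopologicalSpace H] {I : ModelWithCorners ℝ E H}
  {M : Type*} [TopologicalSpace M] [ChartedSpace H M] {x : M}
  {A : Type*} [NormedRing A] [NormedAlgebra ℝ A]

theorem mvfderiv_eq_of_isIdempotentElem {P : M → A} (hP : MDifferentiableAt I 𝓘(ℝ, A) P x)
    (hidem : ∀ x', IsIdempotentElem (P x')) (v : TangentSpace I x) :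
    mvfderiv I P x v = P x * mvfderiv I P x v + mvfderiv I P x v * P x := by
  have h := mvfderiv_bilinear_apply (.mul ℝ A) hP hP v
  simpa only [ContinuousLinearMap.mul_apply', (hidem _).eq] using h

variable [StarRing A] [ContinuousStar A] [StarModule ℝ A]

theorem isSelfAdjoint_mvfderiv {P : M → A} (hP : MDifferentiableAt I 𝓘(ℝ, A) P x)
    (hself : ∀ x', IsSelfAdjoint (P x')) (v : TangentSpace I x) :
    IsSelfAdjoint (mvfderiv I P x v) := by
  have h := mvfderiv_clm_apply_apply (starL' ℝ (A := A)).toContinuousLinearMap hP v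
  have hstar : (fun x' ↦ (starL' ℝ (A := A)).toContinuousLinearMap (P x')) = P :=
    funext fun x' ↦ (hself x').star_eq
  rw [hstar] at h
  exact h.symm

theorem mvfderiv_eq_zero_of_isStarProjection {P : M → A} (hP : MDifferentiableAt I 𝓘(ℝ, A) P x)
    (hproj : ∀ x', IsStarProjection (P x')) (h0 : ∀ v, mvfderiv I P x v * P x = 0) :
    mvfderiv I P x = 0 := by
  ext1 v
  have hself := isSelfAdjoint_mvfderiv hP (fun x' ↦ (hproj x').isSelfAdjoint) v
  have h0' : P x * mvfderiv I P x v = 0 := by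
    simpa [hself.star_eq, (hproj x).isSelfAdjoint.star_eq] using congr(star $(h0 v))
  rw [mvfderiv_eq_of_isIdempotentElem hP (fun x' ↦ (hproj x').isIdempotentElem), h0, h0', add_zero]
  rfl

end DerivStarProjection

section OrthogonalComplement

variable {F : Type*} [NormedAddCommGroup F] [InnerProductSpace ℝ F] {S T : Submodule ℝ F}
  [S.HasOrthogonalProjection] [T.HasOrthogonalProjection]

theorem starProjection_orthogonal_inf [(Sᗮ ⊓ T).HasOrthogonalProjection] (h : S ≤ T) :
    (Sᗮ ⊓ T).starProjection = T.starProjection - S.starProjection := by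
  ext1 x
  refine Submodule.eq_starProjection_of_mem_orthogonal ⟨?_, ?_⟩ ?_
  · have hx := S.sub_starProjection_mem_orthogonal (T.starProjection x)
    rwa [← ContinuousLinearMap.comp_apply,
      Submodule.starProjection_comp_starProjection_of_le h] at hx
  · exact T.sub_mem (T.starProjection_apply_mem x) (h (S.starProjection_apply_mem x))
  · have hT : x - T.starProjection x ∈ (Sᗮ ⊓ T)ᗮ :=
      Submodule.orthogonal_le inf_le_right (T.sub_starProjection_mem_orthogonal x)
    have hS : S.starProjection x ∈ (Sᗮ ⊓ T)ᗮ :=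
      Submodule.orthogonal_le inf_le_left
        (S.le_orthogonal_orthogonal (S.starProjection_apply_mem x))
    simpa only [sub_apply, sub_sub_eq_add_sub, add_sub_right_comm] using Submodule.add_mem _ hT hS

end OrthogonalComplement

section GaussMap

variable {E : Type*} [NormedAddCommGroup E] [NormedSpace ℝ E] [FiniteDimensional ℝ E]
  {H : Type*} [TopologicalSpace H] {I : ModelWithCorners ℝ E H}
  {M : Type*} [TopologicalSpace M] [ChartedSpace H M]
  {F : Type*} [NormedAddCommGroup F] [InnerProductSpace ℝ F]
  {f : M → F} {x : M}

variable (I) in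
/-- The Gauss map of `f`, encoded as the orthogonal projection of `F` onto `f_* T_x M`. -/
def tangentProjection (f : M → F) (x : M) : F →L[ℝ] F :=
  (d% f x).range.starProjection

theorem mvfderiv_tangentProjection_apply_of_eventually_mem
    (hP : MDifferentiableAt I 𝓘(ℝ, F →L[ℝ] F) (tangentProjection I f) x) {s : M → F}
    (hs : MDiffAt s x) (hmem : ∀ᶠ x' in 𝓝 x, s x' ∈ (d% f x').range) (v : TangentSpace I x) :
    mvfderiv I (tangentProjection I f) x v (s x) =
      d% s x v - tangentProjection I f x (d% s x v) := by
  have hPs : (fun x' ↦ tangentProjection I f x' (s x')) =ᶠ[𝓝 x] s :=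
    hmem.mono fun _ h ↦ Submodule.starProjection_eq_self_iff.mpr h
  have h := mvfderiv_bilinear_apply (.id ℝ (F →L[ℝ] F)) hP hs v
  simp only [ContinuousLinearMap.id_apply, mvfderiv_congr_of_eventuallyEq hPs] at h
  exact eq_sub_iff_add_eq'.mpr h.symm

variable [IsManifold I ∞ M] [FiniteDimensional ℝ F]

theorem mdiffAt_tangentProjection (hf : ContMDiff I 𝓘(ℝ, F) ∞ f)
    (hinj : Function.Injective (d% f x)) :
    MDifferentiableAt I 𝓘(ℝ, F →L[ℝ] F) (tangentProjection I f) x := by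
  -- In a local trivialization `A` of `f_*`, a smooth function, the range of `f_*` does not change.
  set A := inTangentCoordinates I 𝓘(ℝ, F) id f (fun x' ↦ mfderiv I 𝓘(ℝ, F) f x') x
  have hAsmooth : MDifferentiableAt I 𝓘(ℝ, E →L[ℝ] F) A x :=
    ((hf x).mfderiv_const (m := 1) (by norm_cast)).mdifferentiableAt one_ne_zero
  have hAeq : ∀ x' ∈ (chartAt H x).source, A x' =
      d% f x' ∘L
        mfderivWithin 𝓘(ℝ, E) I (extChartAt I x).symm (Set.range I) (extChartAt I x x') := by
    intro x' hx'
    have hid : mfderiv 𝓘(ℝ, F) 𝓘(ℝ, F) (extChartAt 𝓘(ℝ, F) (f x)) (f x') = .id ℝ F := by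
      rw [extChartAt_model_space_eq_id]
      exact mfderiv_id
    refine (inTangentCoordinates_eq_mfderiv_comp hx' (Set.mem_univ _)).trans ?_
    ext1 v
    exact congr($hid _)
  have hAx : Function.Injective (A x) := by
    rw [hAeq x (mem_chart_source H x)]
    exact hinj.comp (isInvertible_mfderivWithin_extChartAt_symm (mem_extChartAt_target x)).injective
  have hproj : MDifferentiableAt I 𝓘(ℝ, F →L[ℝ] F) (fun x' ↦ (A x').range.starProjection) x :=
    (((contDiffAt_starProjection_range hAx).differentiableAt one_ne_zero).mdifferentiableAt).comp x
      hAsmooth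
  refine hproj.congr_of_eventuallyEq ?_
  filter_upwards [(chartAt H x).open_source.mem_nhds (mem_chart_source H x)] with x' hx'
  have hsurj := (isInvertible_mfderivWithin_extChartAt_symm (I := I)
    ((extChartAt I x).map_source (by rwa [extChartAt_source]))).surjective
  simp only [tangentProjection, hAeq x' hx']
  congr 1
  exact (LinearMap.range_comp_of_range_eq_top _ (LinearMap.range_eq_top.mpr hsurj)).symm

end GaussMap

section LieBracket

variable {E : Type*} [NormedAddCommGroup E] [NormedSpace ℝ E]
  {H : Type*} [TopologicalSpace H] {I : ModelWithCorners ℝ E H}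
  {M : Type*} [TopologicalSpace M] [ChartedSpace H M]
  {G : Type*} [NormedAddCommGroup G] [NormedSpace ℝ G]
  {f : M → G} {X Y : Π x : M, TangentSpace I x} {x : M}

theorem mvfderiv_eq_fderivWithin_comp_extChartAt_symm {g : M → G} (hg : MDiffAt g x) :
    d% g x = fderivWithin ℝ (g ∘ (extChartAt I x).symm) (Set.range I) (extChartAt I x x) := by
  rw [hg.mvfderiv]
  rfl

theorem fderivWithin_comp_extChartAt_symm_mpullbackWithin [IsManifold I 1 M] {z : E}
    (hz : z ∈ (extChartAt I x).target) (hf : MDiffAt f ((extChartAt I x).symm z)) :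
    fderivWithin ℝ (f ∘ (extChartAt I x).symm) (Set.range I) z
        (mpullbackWithin 𝓘(ℝ, E) I (extChartAt I x).symm Y (Set.range I) z) =
      d% f ((extChartAt I x).symm z) (Y ((extChartAt I x).symm z)) := by
  have hcomp := mfderiv_comp_mfderivWithin z hf (mdifferentiableWithinAt_extChartAt_symm hz)
    (I.uniqueMDiffOn z (extChartAt_target_subset_range x hz))
  rw [← mfderivWithin_eq_fderivWithin, hcomp]
  exact congr(d% f _ $((isInvertible_mfderivWithin_extChartAt_symm hz).self_apply_inverse _))

theorem mpullbackWithin_extChartAt_symm_self [IsManifold I 1 M] :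
    mpullbackWithin 𝓘(ℝ, E) I (extChartAt I x).symm Y (Set.range I) (extChartAt I x x) = Y x :=
  (mfderivWithin_extChartAt_symm_inverse_apply (I := I) (x := x) _).trans
    (congrArg (β := E) Y (extChartAt_to_inv x))

theorem mvfderiv_pushforward_eq [IsManifold I 1 M] (hf : MDiff f)
    (hp : MDiffAt (fun x' ↦ d% f x' (Y x')) x) (v : TangentSpace I x) :
    d% (fun x' ↦ d% f x' (Y x')) x v =
      fderivWithin ℝ (fun z ↦ fderivWithin ℝ (f ∘ (extChartAt I x).symm) (Set.range I) z
        (mpullbackWithin 𝓘(ℝ, E) I (extChartAt I x).symm Y (Set.range I) z)) (Set.range I)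
        (extChartAt I x x) v := by
  rw [mvfderiv_eq_fderivWithin_comp_extChartAt_symm hp]
  congr 1
  refine Filter.EventuallyEq.fderivWithin_eq_of_mem ?_ (by simp)
  filter_upwards [extChartAt_target_mem_nhdsWithin (I := I) x] with z hz
  exact (fderivWithin_comp_extChartAt_symm_mpullbackWithin hz (hf _)).symm

theorem mlieBracket_eq_lieBracketWithin [IsManifold I 1 M]
    (X Y : Π x : M, TangentSpace I x) (x : M) :
    mlieBracket I X Y x = lieBracketWithin ℝ
      (mpullbackWithin 𝓘(ℝ, E) I (extChartAt I x).symm X (Set.range I))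
      (mpullbackWithin 𝓘(ℝ, E) I (extChartAt I x).symm Y (Set.range I)) (Set.range I)
      (extChartAt I x x) := by
  have hid : (mfderiv I 𝓘(ℝ, E) (extChartAt I x) x : E →L[ℝ] E) = .id ℝ E :=
    mfderiv_extChartAt_self
  have hinv := congr(($hid).inverse).trans ContinuousLinearMap.inverse_id
  rw [← mlieBracketWithin_univ, mlieBracketWithin_apply, Set.preimage_univ, Set.univ_inter]
  exact congr($hinv _)

theorem mvfderiv_apply_mlieBracket [CompleteSpace E] [IsManifold I ∞ M]
    (hf : ContMDiff I 𝓘(ℝ, G) ∞ f) (hX : MDiffAt (T% X) x) (hY : MDiffAt (T% Y) x)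
    (hfX : MDiffAt (fun x' ↦ d% f x' (X x')) x) (hfY : MDiffAt (fun x' ↦ d% f x' (Y x')) x) :
    d% f x (mlieBracket I X Y x) =
      d% (fun x' ↦ d% f x' (Y x')) x (X x) - d% (fun x' ↦ d% f x' (X x')) x (Y x) := by
  have hf1 : MDiff f := hf.mdifferentiable (by simp)
  have hf' : ContDiffWithinAt ℝ ∞ (f ∘ (extChartAt I x).symm) (Set.range I) (extChartAt I x x) :=
    (contMDiffAt_iff.mp (hf x)).2
  have hX' :=
    hX.mdifferentiableWithinAt (s := .univ) |>.differentiableWithinAt_mpullbackWithin_vectorField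
  have hY' :=
    hY.mdifferentiableWithinAt (s := .univ) |>.differentiableWithinAt_mpullbackWithin_vectorField
  rw [Set.preimage_univ, Set.univ_inter] at hX' hY'
  have h := fderivWithin_apply_lieBracket hf' (by simp; norm_cast) I.uniqueDiffOn
    (I.range_subset_closure_interior ⟨_, rfl⟩) ⟨_, rfl⟩ hY' hX'
  rw [mvfderiv_pushforward_eq hf1 hfX, mvfderiv_pushforward_eq hf1 hfY,
    mvfderiv_eq_fderivWithin_comp_extChartAt_symm (hf1 x), mlieBracket_eq_lieBracketWithin]
  rw [mpullbackWithin_extChartAt_symm_self, mpullbackWithin_extChartAt_symm_self] at h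
  exact h

end LieBracket

section ImmersionDerivative

variable {𝕜 : Type*} [NontriviallyNormedField 𝕜]
  {E : Type*} [NormedAddCommGroup E] [NormedSpace 𝕜 E]
  {H : Type*} [TopologicalSpace H] {I : ModelWithCorners 𝕜 E H}
  {M : Type*} [TopologicalSpace M] [ChartedSpace H M]
  {E' : Type*} [NormedAddCommGroup E'] [NormedSpace 𝕜 E']
  {H' : Type*} [TopologicalSpace H'] {J : ModelWithCorners 𝕜 E' H'}
  {L : Type*} [TopologicalSpace L] [ChartedSpace H' L]
  {ι : L → M} {y : L} {n : ℕ∞ω}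

theorem mfderiv_codChart_extend_mfderiv (h : IsImmersionAt J I n ι y) (hn : n ≠ 0) {y' : L}
    (hy' : y' ∈ h.domChart.source) (u : TangentSpace J y') :
    mfderiv I 𝓘(𝕜, E) (h.codChart.extend I) (ι y') (mfderiv J I ι y' u) =
      h.equiv (mfderiv J 𝓘(𝕜, E') (h.domChart.extend J) y' u, 0) := by
  set j : E' →L[𝕜] E := h.equiv ∘L .inl 𝕜 E' h.complement
  have hcod := (h.codChart.contMDiffAt_extend h.codChart_mem_maximalAtlas
    (h.source_subset_preimage_source hy')).mdifferentiableAt hn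
  have hdom := (h.domChart.contMDiffAt_extend h.domChart_mem_maximalAtlas hy').mdifferentiableAt hn
  have hι : MDiffAt ι y' :=
    (h.contMDiffOn.contMDiffAt (h.domChart.open_source.mem_nhds hy')).mdifferentiableAt hn
  have hcharts : h.codChart.extend I ∘ ι =ᶠ[𝓝 y'] j ∘ h.domChart.extend J := by
    filter_upwards [h.domChart.extend_source_mem_nhds (I := J) hy'] with z hz
    have hw := h.writtenInCharts ((h.domChart.extend J).map_source hz)
    simp only [Function.comp_apply, (h.domChart.extend J).left_inv hz] at hw
    exact hw
  have hj := mfderiv_comp y' j.differentiableAt.mdifferentiableAt hdom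
  rw [← hcharts.mfderiv_eq, mfderiv_comp y' hcod hι, mfderiv_eq_fderiv, j.fderiv] at hj
  exact congr($hj u)

theorem isLocalDiffeomorphAt_extend [I.Boundaryless] {e : OpenPartialHomeomorph M H}
    (he : e ∈ IsManifold.maximalAtlas I n M) {x : M} (hx : x ∈ e.source) :
    IsLocalDiffeomorphAt I 𝓘(𝕜, E) n (e.extend I) x :=
  ⟨{ toPartialEquiv := e.extend I
     open_source := e.isOpen_extend_source
     open_target := e.isOpen_extend_target
     contMDiffOn_toFun := (e.contMDiffOn_extend he).mono e.extend_source.subset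
     contMDiffOn_invFun :=
       (contMDiffOn_extend_symm he).mono (by rw [I.image_eq, e.extend_target]) },
    e.extend_source.superset hx, Set.eqOn_refl _ _⟩

theorem isInvertible_mfderiv_extend [I.Boundaryless] [IsManifold I n M]
    {e : OpenPartialHomeomorph M H}
    (he : e ∈ IsManifold.maximalAtlas I n M) (hn : n ≠ 0) {x : M} (hx : x ∈ e.source) :
    (mfderiv I 𝓘(𝕜, E) (e.extend I) x).IsInvertible :=
  ⟨(isLocalDiffeomorphAt_extend he hx).mfderivToContinuousLinearEquiv hn, rfl⟩

variable [J.Boundaryless]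

theorem injective_mfderiv_of_isImmersionAt [IsManifold J n L]
    (h : IsImmersionAt J I n ι y) (hn : n ≠ 0) :
    Function.Injective (mfderiv J I ι y) := by
  intro u u' huu
  have hy := h.mem_domChart_source
  have heq := (mfderiv_codChart_extend_mfderiv h hn hy u).symm.trans
    ((congrArg _ huu).trans (mfderiv_codChart_extend_mfderiv h hn hy u'))
  exact (isInvertible_mfderiv_extend h.domChart_mem_maximalAtlas hn hy).injective
    (congrArg Prod.fst (h.equiv.injective heq))

theorem exists_vectorField_mem_range_mfderiv [CompleteSpace E] [I.Boundaryless]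
    [IsManifold I ∞ M] [IsManifold J ∞ L] (h : IsImmersionAt J I ∞ ι y) (u : TangentSpace J y) :
    ∃ X : Π x : M, TangentSpace I x, X (ι y) = mfderiv J I ι y u ∧
      (∀ᶠ x in 𝓝 (ι y), ContMDiffAt I I.tangent ∞ (T% X) x) ∧
      ∀ᶠ y' in 𝓝 y, X (ι y') ∈ (mfderiv J I ι y').range := by
  have hn : (∞ : ℕ∞ω) ≠ 0 := by simp
  set φ := h.codChart.extend I
  have hφ : ∀ x ∈ h.codChart.source, (mfderiv I 𝓘(𝕜, E) φ x).IsInvertible := fun x hx ↦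
    isInvertible_mfderiv_extend h.codChart_mem_maximalAtlas hn hx
  set b : E' := mfderiv J 𝓘(𝕜, E') (h.domChart.extend J) y u
  have hX : ∀ y' ∈ h.domChart.source, ∀ u', mfderiv J 𝓘(𝕜, E') (h.domChart.extend J) y' u' = b →
      (mfderiv I 𝓘(𝕜, E) φ (ι y')).inverse (h.equiv (b, 0)) = mfderiv J I ι y' u' := by
    rintro y' hy' u' hu'
    have heq := mfderiv_codChart_extend_mfderiv h hn hy' u'
    rw [hu'] at heq
    exact (congrArg _ heq.symm).trans
      ((hφ _ (h.source_subset_preimage_source hy')).inverse_apply_self _)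
  let c : Π z : E, TangentSpace 𝓘(𝕜, E) z := fun _ ↦ h.equiv (b, 0)
  have hc : ∀ z, ContMDiffAt 𝓘(𝕜, E) 𝓘(𝕜, E).tangent ∞ (T% c) z := fun _ ↦
    contMDiffAt_vectorSpace_iff_contDiffAt.mpr contDiffAt_const
  refine ⟨mpullback I 𝓘(𝕜, E) φ c, hX y h.mem_domChart_source u rfl, ?_, ?_⟩
  · filter_upwards [h.codChart.open_source.mem_nhds h.mem_codChart_source] with x hx
    exact .mpullback_vectorField_preimage (hc _)
      (h.codChart.contMDiffAt_extend h.codChart_mem_maximalAtlas hx) (hφ x hx) (by simp)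
  · filter_upwards [h.domChart.open_source.mem_nhds h.mem_domChart_source] with y' hy'
    obtain ⟨u', hu'⟩ :=
      (isInvertible_mfderiv_extend h.domChart_mem_maximalAtlas hn hy').surjective b
    exact ⟨u', (hX y' hy' u' hu').symm⟩

end ImmersionDerivative

section GaussFormula

variable {E : Type*} [NormedAddCommGroup E] [NormedSpace ℝ E] [FiniteDimensional ℝ E]
  {H : Type*} [TopologicalSpace H] {I : ModelWithCorners ℝ E H}
  {M : Type*} [TopologicalSpace M] [ChartedSpace H M] [IsManifold I ∞ M]
  {F : Type*} [NormedAddCommGroup F] [InnerProductSpace ℝ F] [FiniteDimensional ℝ F]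
  {f : M → F} {x : M}

theorem secondFundamentalForm_eq_sub_tangentProjection (hf : ContMDiff I 𝓘(ℝ, F) ∞ f)
    {Y : Π x : M, TangentSpace I x} (hY : MDiffAt (T% Y) x) (v : TangentSpace I x) :
    (secondFundamentalForm f hf x v (Y x) : F) =
      d% (fun x' ↦ d% f x' (Y x')) x v -
        tangentProjection I f x (d% (fun x' ↦ d% f x' (Y x')) x v) := by
  have hv := FiberBundle.mdifferentiableAt_extend I E (V := fun x : M ↦ TangentSpace I x) v
  have h := secondFundamentalForm_apply hf hv hY
  rw [FiberBundle.extend_apply_self] at h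
  rw [h]
  exact Submodule.starProjection_orthogonal_val _

theorem mvfderiv_tangentProjection_apply (hf : ContMDiff I 𝓘(ℝ, F) ∞ f)
    (hinj : Function.Injective (d% f x)) (v w : TangentSpace I x) :
    mvfderiv I (tangentProjection I f) x v (d% f x w) = secondFundamentalForm f hf x v w := by
  set Y : Π x : M, TangentSpace I x := FiberBundle.extend E w
  have hY : MDiffAt (T% Y) x :=
    FiberBundle.mdifferentiableAt_extend I E (V := fun x : M ↦ TangentSpace I x) w
  have hYx : Y x = w := FiberBundle.extend_apply_self _ _
  rw [← hYx, secondFundamentalForm_eq_sub_tangentProjection hf hY]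
  exact mvfderiv_tangentProjection_apply_of_eventually_mem (mdiffAt_tangentProjection hf hinj)
    (mdiffAt_pushforward hf hY) (.of_forall fun _ ↦ ⟨_, rfl⟩) v

theorem mvfderiv_tangentProjection_apply_eq_zero (hf : ContMDiff I 𝓘(ℝ, F) ∞ f)
    (hinj : Function.Injective (d% f x)) {v : TangentSpace I x} {k : F}
    (hk : k ∈ normalSpace I f x)
    (hα : ∀ w, ⟪(secondFundamentalForm f hf x v w : F), k⟫_ℝ = 0) :
    mvfderiv I (tangentProjection I f) x v k = 0 := by
  have hP := mdiffAt_tangentProjection hf hinj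
  have hself : IsSelfAdjoint (mvfderiv I (tangentProjection I f) x v) :=
    isSelfAdjoint_mvfderiv hP (fun _ ↦ isSelfAdjoint_starProjection _) v
  have hPk : tangentProjection I f x k = 0 :=
    (Submodule.starProjection_apply_eq_zero_iff _).mpr hk
  obtain ⟨w, hw⟩ : mvfderiv I (tangentProjection I f) x v k ∈ (d% f x).range := by
    have h := congr($(mvfderiv_eq_of_isIdempotentElem hP
      (fun _ ↦ Submodule.isIdempotentElem_starProjection _) v) k)
    rw [add_apply, mul_apply_eq_comp, mul_apply_eq_comp, hPk, map_zero,
      add_zero] at h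
    exact Submodule.starProjection_eq_self_iff.mp h.symm
  rw [← inner_self_eq_zero (𝕜 := ℝ)]
  nth_rw 2 [← hw]
  rw [real_inner_comm, ← ContinuousLinearMap.adjoint_inner_left, hself.adjoint_eq]
  exact (congr(⟪$(mvfderiv_tangentProjection_apply hf hinj v w), k⟫_ℝ)).trans (hα w)

end GaussFormula

namespace IsIsometricImmersion

variable {E : Type*} [NormedAddCommGroup E] [NormedSpace ℝ E]
  {H : Type*} [TopologicalSpace H] {I : ModelWithCorners ℝ E H}
  {M : Type*} [TopologicalSpace M] [ChartedSpace H M]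
  [RiemannianBundle (fun x : M ↦ TangentSpace I x)]
  {F : Type*} [NormedAddCommGroup F] [InnerProductSpace ℝ F]
  {f : M → F} {x : M}

theorem injective_mvfderiv (hf : IsIsometricImmersion I f) (x : M) :
    Function.Injective (d% f x) := by
  rw [injective_iff_map_eq_zero]
  intro v hv
  rw [← inner_self_eq_zero (𝕜 := ℝ), ← hf.inner_eq, hv, inner_zero_left]

theorem injective_mvfderiv_comp {E' : Type*} [NormedAddCommGroup E'] [NormedSpace ℝ E']
    {H' : Type*} [TopologicalSpace H'] {J : ModelWithCorners ℝ E' H'} [J.Boundaryless]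
    {L : Type*} [TopologicalSpace L] [ChartedSpace H' L] [IsManifold J ∞ L] {ι : L → M} {y : L}
    (hf : IsIsometricImmersion I f) (hι : IsImmersionAt J I ∞ ι y) :
    Function.Injective (d% (f ∘ ι) y) :=
  _root_.injective_mvfderiv_comp ((hf.contMDiff _).mdifferentiableAt (by simp))
    (hι.contMDiffAt.mdifferentiableAt (by simp)) (hf.injective_mvfderiv _)
    (injective_mfderiv_of_isImmersionAt hι (by simp))

variable [FiniteDimensional ℝ E] [IsManifold I ∞ M] [FiniteDimensional ℝ F]

theorem mvfderiv_inner_eq (hf : IsIsometricImmersion I f) {Y Z : Π x : M, TangentSpace I x}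
    (hY : MDiffAt (T% Y) x) (hZ : MDiffAt (T% Z) x) (v : TangentSpace I x) :
    d% (fun x' ↦ ⟪Y x', Z x'⟫_ℝ) x v =
      ⟪d% f x (Y x), d% (fun x' ↦ d% f x' (Z x')) x v⟫_ℝ +
        ⟪d% (fun x' ↦ d% f x' (Y x')) x v, d% f x (Z x)⟫_ℝ := by
  simp only [← hf.inner_eq]
  exact mvfderiv_bilinear_apply (innerSL ℝ) (mdiffAt_pushforward hf.contMDiff hY)
    (mdiffAt_pushforward hf.contMDiff hZ) v

theorem inner_mlieBracket_eq (hf : IsIsometricImmersion I f) {X Y : Π x : M, TangentSpace I x}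
    (hX : MDiffAt (T% X) x) (hY : MDiffAt (T% Y) x) (w : TangentSpace I x) :
    ⟪mlieBracket I X Y x, w⟫_ℝ =
      ⟪d% (fun x' ↦ d% f x' (Y x')) x (X x), d% f x w⟫_ℝ -
        ⟪d% (fun x' ↦ d% f x' (X x')) x (Y x), d% f x w⟫_ℝ := by
  rw [← hf.inner_eq, mvfderiv_apply_mlieBracket hf.contMDiff hX hY
    (mdiffAt_pushforward hf.contMDiff hX) (mdiffAt_pushforward hf.contMDiff hY), inner_sub_left]

variable [IsContMDiffRiemannianBundle I ∞ E (fun x : M ↦ TangentSpace I x)]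

theorem inner_leviCivita_eq (hf : IsIsometricImmersion I f) {Y : Π x : M, TangentSpace I x}
    (hY : MDiffAt (T% Y) x) (v w : TangentSpace I x) :
    ⟪leviCivita I M Y x v, w⟫_ℝ = ⟪d% (fun x' ↦ d% f x' (Y x')) x v, d% f x w⟫_ℝ := by
  have hX := FiberBundle.mdifferentiableAt_extend I E (V := fun x : M ↦ TangentSpace I x) v
  have hZ := FiberBundle.mdifferentiableAt_extend I E (V := fun x : M ↦ TangentSpace I x) w
  have h := inner_leviCivita hX hY hZ
  rw [koszul, hf.mvfderiv_inner_eq hY hZ, hf.mvfderiv_inner_eq hX hZ,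
    hf.mvfderiv_inner_eq hX hY, hf.inner_mlieBracket_eq hX hY, hf.inner_mlieBracket_eq hX hZ,
    hf.inner_mlieBracket_eq hY hZ] at h
  simp only [FiberBundle.extend_apply_self] at h
  rw [h]
  simp only [real_inner_comm (d% f x _)]
  ring

theorem mvfderiv_pushforward_apply (hf : IsIsometricImmersion I f) {Y : Π x : M, TangentSpace I x}
    (hY : MDiffAt (T% Y) x) (v : TangentSpace I x) :
    d% (fun x' ↦ d% f x' (Y x')) x v =
      d% f x (leviCivita I M Y x v) + secondFundamentalForm f hf.contMDiff x v (Y x) := by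
  have htangent : tangentProjection I f x (d% (fun x' ↦ d% f x' (Y x')) x v) =
      d% f x (leviCivita I M Y x v) := by
    refine Submodule.eq_starProjection_of_mem_of_inner_eq_zero ⟨_, rfl⟩ ?_
    rintro _ ⟨w, rfl⟩
    exact (inner_sub_left _ _ _).trans (sub_eq_zero.mpr
      ((hf.inner_leviCivita_eq hY v w).symm.trans (hf.inner_eq ..).symm))
  rw [← htangent, secondFundamentalForm_eq_sub_tangentProjection hf.contMDiff hY, add_sub_cancel]

end IsIsometricImmersion

section RelativeNormalSpace

variable {E : Type*} [NormedAddCommGroup E] [NormedSpace ℝ E] [FiniteDimensional ℝ E]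
  {H : Type*} [TopologicalSpace H] {I : ModelWithCorners ℝ E H}
  {M : Type*} [TopologicalSpace M] [ChartedSpace H M]
  {E' : Type*} [NormedAddCommGroup E'] [NormedSpace ℝ E']
  {H' : Type*} [TopologicalSpace H'] {J : ModelWithCorners ℝ E' H'}
  {L : Type*} [TopologicalSpace L] [ChartedSpace H' L]
  {F : Type*} [NormedAddCommGroup F] [InnerProductSpace ℝ F]
  {f : M → F} {ι : L → M} {y : L}

variable (I J) in
/-- The image under `f` of the normal space of `ι : L → M` at `y`, that is, the space of vectors
tangent to `f` and normal to `f ∘ ι`. -/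
def relativeNormalSpace (f : M → F) (ι : L → M) (y : L) : Submodule ℝ F :=
  normalSpace J (f ∘ ι) y ⊓ (d% f (ι y)).range

variable [FiniteDimensional ℝ F]

theorem finrank_orthogonal_relativeNormalSpace {p : ℕ}
    (hp : Module.finrank ℝ F = Module.finrank ℝ E + p) (hf : MDiffAt f (ι y)) (hι : MDiffAt ι y)
    (hinj : Function.Injective (d% f (ι y))) (hinj' : Function.Injective (d% (f ∘ ι) y)) :
    Module.finrank ℝ (relativeNormalSpace I J f ι y)ᗮ = Module.finrank ℝ E' + p := by
  have hrel := Submodule.finrank_add_inf_finrank_orthogonal (range_mvfderiv_comp_le hf hι)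
  have hcompl := (relativeNormalSpace I J f ι y).finrank_add_finrank_orthogonal
  have hT : Module.finrank ℝ (d% f (ι y)).range = Module.finrank ℝ E :=
    LinearMap.finrank_range_of_inj hinj
  have hS : Module.finrank ℝ (d% (f ∘ ι) y).range = Module.finrank ℝ E' :=
    LinearMap.finrank_range_of_inj hinj'
  rw [relativeNormalSpace, normalSpace] at hcompl ⊢
  omega

variable [FiniteDimensional ℝ E']

theorem starProjection_relativeNormalSpace_eq_sub (hf : MDiff f) (hι : MDiff ι) :
    (fun y ↦ (relativeNormalSpace I J f ι y).starProjection) =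
      tangentProjection I f ∘ ι - tangentProjection J (f ∘ ι) :=
  funext fun y ↦ starProjection_orthogonal_inf (range_mvfderiv_comp_le (hf (ι y)) (hι y))

end RelativeNormalSpace

namespace IsIsometricImmersion

variable {E : Type*} [NormedAddCommGroup E] [NormedSpace ℝ E] [FiniteDimensional ℝ E]
  {H : Type*} [TopologicalSpace H] {I : ModelWithCorners ℝ E H}
  {M : Type*} [TopologicalSpace M] [ChartedSpace H M] [IsManifold I ∞ M]
  [RiemannianBundle (fun x : M ↦ TangentSpace I x)]
  {E' : Type*} [NormedAddCommGroup E'] [NormedSpace ℝ E']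
  {H' : Type*} [TopologicalSpace H'] {J : ModelWithCorners ℝ E' H'}
  {L : Type*} [TopologicalSpace L] [ChartedSpace H' L]
  {F : Type*} [NormedAddCommGroup F] [InnerProductSpace ℝ F] [FiniteDimensional ℝ F]
  {f : M → F} {ι : L → M} {y : L}

theorem secondFundamentalForm_apply_eq_zero_of_mem_normalSpace_comp
    (hf : IsIsometricImmersion I f) (hι : MDiffAt ι y) {v w : TangentSpace I (ι y)}
    (hv : ∀ ξ,
      shapeOperator (secondFundamentalForm f hf.contMDiff (ι y)) ξ v ∈ tangentSubspace I J ι y)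
    (hw : d% f (ι y) w ∈ normalSpace J (f ∘ ι) y) :
    secondFundamentalForm f hf.contMDiff (ι y) v w = 0 := by
  refine ext_inner_right ℝ fun ξ ↦ ?_
  obtain ⟨u, hu⟩ := hv ξ
  have hu' : d% (f ∘ ι) y u = d% f (ι y) (mfderiv J I ι y u) :=
    mvfderiv_comp_mfderiv_apply ((hf.contMDiff _).mdifferentiableAt (by simp)) hι u
  rw [← inner_shapeOperator, inner_zero_left, ← hu, ← hf.inner_eq]
  exact hu' ▸ hw _ ⟨u, rfl⟩

variable [FiniteDimensional ℝ E'] [J.Boundaryless] [IsManifold J ∞ L]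

theorem mdiffAt_starProjection_relativeNormalSpace (hf : IsIsometricImmersion I f)
    (hι : IsImmersion J I ∞ ι) (y : L) :
    MDifferentiableAt J 𝓘(ℝ, F →L[ℝ] F)
      (fun y' ↦ (relativeNormalSpace I J f ι y').starProjection) y := by
  rw [starProjection_relativeNormalSpace_eq_sub (hf.contMDiff.mdifferentiable (by simp))
    (hι.contMDiff.mdifferentiable (by simp))]
  exact ((mdiffAt_tangentProjection hf.contMDiff (hf.injective_mvfderiv _)).comp y
    ((hι.contMDiff y).mdifferentiableAt (by simp))).sub
    (mdiffAt_tangentProjection (hf.contMDiff.comp hι.contMDiff)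
      (hf.injective_mvfderiv_comp (hι.isImmersionAt y)))

theorem mvfderiv_starProjection_relativeNormalSpace_apply (hf : IsIsometricImmersion I f)
    (hι : IsImmersion J I ∞ ι) (v : TangentSpace J y) (w : TangentSpace I (ι y)) :
    mvfderiv J (fun y' ↦ (relativeNormalSpace I J f ι y').starProjection) y v (d% f (ι y) w) =
      secondFundamentalForm f hf.contMDiff (ι y) (mfderiv J I ι y v) w -
        mvfderiv J (tangentProjection J (f ∘ ι)) y v (d% f (ι y) w) := by
  have hιd : MDiff ι := hι.contMDiff.mdifferentiable (by simp)
  have hT := mdiffAt_tangentProjection hf.contMDiff (hf.injective_mvfderiv (ι y))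
  have hS := mdiffAt_tangentProjection (hf.contMDiff.comp hι.contMDiff)
    (hf.injective_mvfderiv_comp (hι.isImmersionAt y))
  rw [starProjection_relativeNormalSpace_eq_sub (hf.contMDiff.mdifferentiable (by simp)) hιd,
    mvfderiv_sub (hT.comp y (hιd y)) hS, sub_apply, sub_apply,
    mvfderiv_comp_mfderiv_apply hT (hιd y),
    mvfderiv_tangentProjection_apply hf.contMDiff (hf.injective_mvfderiv _)]

variable [I.Boundaryless] [IsContMDiffRiemannianBundle I ∞ E (fun x : M ↦ TangentSpace I x)]

theorem secondFundamentalForm_comp_apply (hf : IsIsometricImmersion I f) (hι : IsImmersion J I ∞ ι)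
    (hgeo : IsTotallyGeodesic I J ι) (v u : TangentSpace J y) :
    (secondFundamentalForm (f ∘ ι) (hf.contMDiff.comp hι.contMDiff) y v u : F) =
      secondFundamentalForm f hf.contMDiff (ι y) (mfderiv J I ι y v) (mfderiv J I ι y u) := by
  have hfd (x : M) : MDiffAt f x := (hf.contMDiff x).mdifferentiableAt (by simp)
  have hιd (y' : L) : MDiffAt ι y' := (hι.contMDiff y').mdifferentiableAt (by simp)
  obtain ⟨X, hXy, hXsmooth, hXmem⟩ := exists_vectorField_mem_range_mfderiv (hι.isImmersionAt y) u
  have hX : MDiffAt (T% X) (ι y) := hXsmooth.self_of_nhds.mdifferentiableAt (by simp)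
  have hs := mdiffAt_pushforward hf.contMDiff hX
  obtain ⟨w, hw⟩ : ∃ w, mfderiv J I ι y w = leviCivita I M X (ι y) (mfderiv J I ι y v) :=
    hgeo y X hXsmooth hXmem _ ⟨v, rfl⟩
  have hgauss : d% ((fun x ↦ d% f x (X x)) ∘ ι) y v = d% (f ∘ ι) y w +
      secondFundamentalForm f hf.contMDiff (ι y) (mfderiv J I ι y v) (mfderiv J I ι y u) := by
    rw [mvfderiv_comp_mfderiv_apply hs (hιd y), hf.mvfderiv_pushforward_apply hX, ← hw, hXy,
      mvfderiv_comp_mfderiv_apply (hfd _) (hιd y)]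
  have htangent : tangentProjection J (f ∘ ι) y (d% (f ∘ ι) y w) = d% (f ∘ ι) y w :=
    Submodule.starProjection_eq_self_iff.mpr ⟨w, rfl⟩
  have hnormal : tangentProjection J (f ∘ ι) y (secondFundamentalForm f hf.contMDiff (ι y)
      (mfderiv J I ι y v) (mfderiv J I ι y u)) = 0 :=
    (Submodule.starProjection_apply_eq_zero_iff _).mpr
      (Submodule.orthogonal_le (range_mvfderiv_comp_le (hfd _) (hιd y)) (Subtype.property _))
  have hg := hf.contMDiff.comp hι.contMDiff
  have hinj := hf.injective_mvfderiv_comp (hι.isImmersionAt y)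
  have h := mvfderiv_tangentProjection_apply_of_eventually_mem (mdiffAt_tangentProjection hg hinj)
    (hs.comp y (hιd y)) (hXmem.mono fun y' ⟨z, hz⟩ ↦
      ⟨z, (mvfderiv_comp_mfderiv_apply (hfd _) (hιd y') z).trans congr(d% f (ι y') $hz)⟩) v
  rw [hgauss, map_add, htangent, hnormal, add_zero, add_sub_cancel_left] at h
  rw [← mvfderiv_tangentProjection_apply hg hinj, ← h,
    mvfderiv_comp_mfderiv_apply (hfd _) (hιd y), Function.comp_apply, hXy]

theorem mvfderiv_starProjection_relativeNormalSpace_eq_zero (hf : IsIsometricImmersion I f)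
    (hι : IsImmersion J I ∞ ι) (hgeo : IsTotallyGeodesic I J ι)
    (hadapted : ∀ ξ, ∀ X ∈ tangentSubspace I J ι y,
      shapeOperator (secondFundamentalForm f hf.contMDiff (ι y)) ξ X ∈ tangentSubspace I J ι y) :
    mvfderiv J (fun y' ↦ (relativeNormalSpace I J f ι y').starProjection) y = 0 := by
  refine mvfderiv_eq_zero_of_isStarProjection
    (mdiffAt_starProjection_relativeNormalSpace hf hι y)
    (fun _ ↦ isStarProjection_starProjection) fun v ↦ ?_
  ext1 z
  obtain ⟨hnormal, w, hw⟩ := (relativeNormalSpace I J f ι y).starProjection_apply_mem z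
  replace hw : d% f (ι y) w = (relativeNormalSpace I J f ι y).starProjection z := hw
  rw [← hw] at hnormal
  have hα : secondFundamentalForm f hf.contMDiff (ι y) (mfderiv J I ι y v) w = 0 :=
    hf.secondFundamentalForm_apply_eq_zero_of_mem_normalSpace_comp
      ((hι.contMDiff y).mdifferentiableAt (by simp)) (fun ξ ↦ hadapted ξ _ ⟨v, rfl⟩) hnormal
  have hS : mvfderiv J (tangentProjection J (f ∘ ι)) y v (d% f (ι y) w) = 0 := by
    refine mvfderiv_tangentProjection_apply_eq_zero (hf.contMDiff.comp hι.contMDiff)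
      (hf.injective_mvfderiv_comp (hι.isImmersionAt y)) hnormal fun u ↦ ?_
    rw [hf.secondFundamentalForm_comp_apply hι hgeo]
    exact Submodule.inner_left_of_mem_orthogonal (K := (d% f (ι y)).range) ⟨w, rfl⟩
      (Subtype.property _)
  rw [mul_apply_eq_comp, ← hw, hf.mvfderiv_starProjection_relativeNormalSpace_apply hι, hα, hS]
  simp

end IsIsometricImmersion

end

theorem proposition3_general
    {E : Type*} [NormedAddCommGroup E] [NormedSpace ℝ E] [FiniteDimensional ℝ E]
    {H : Type*} [TopologicalSpace H] {I : ModelWithCorners ℝ E H} [I.Boundaryless]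
    {M : Type*} [TopologicalSpace M] [ChartedSpace H M] [IsManifold I ∞ M]
    [RiemannianBundle (fun x : M ↦ TangentSpace I x)]
    [IsContMDiffRiemannianBundle I ∞ E (fun x : M ↦ TangentSpace I x)]
    {E' : Type*} [NormedAddCommGroup E'] [NormedSpace ℝ E'] [FiniteDimensional ℝ E']
    {H' : Type*} [TopologicalSpace H'] {J : ModelWithCorners ℝ E' H'} [J.Boundaryless]
    {L : Type*} [TopologicalSpace L] [ConnectedSpace L] [ChartedSpace H' L] [IsManifold J ∞ L]
    {F : Type*} [NormedAddCommGroup F] [InnerProductSpace ℝ F] [FiniteDimensional ℝ F] {p : ℕ}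
    (hp : Module.finrank ℝ F = Module.finrank ℝ E + p)
    {f : M → F} (hf : IsIsometricImmersion I f) {ι : L → M} (hι : IsImmersion J I ∞ ι)
    (hgeo : IsTotallyGeodesic I J ι)
    (hadapted : ∀ y, ∀ ξ, ∀ X ∈ tangentSubspace I J ι y,
      shapeOperator (secondFundamentalForm f hf.contMDiff (ι y)) ξ X ∈ tangentSubspace I J ι y) :
    AdmitsReductionOfCodimension (Module.finrank ℝ E') (f ∘ ι) p := by
  have hg := hf.contMDiff.comp hι.contMDiff
  let C := relativeNormalSpace I J f ι
  obtain ⟨y₀⟩ : Nonempty L := inferInstance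
  have hproj : IsLocallyConstant fun y ↦ (C y).starProjection :=
    isLocallyConstant_of_mvfderiv_eq_zero (I := J)
      (hf.mdiffAt_starProjection_relativeNormalSpace hι)
      fun y ↦ hf.mvfderiv_starProjection_relativeNormalSpace_eq_zero hι hgeo (hadapted y)
  have hconst (y : L) : C y = C y₀ :=
    Submodule.starProjection_inj.mp (hproj.apply_eq_of_preconnectedSpace y y₀)
  have htangent (y : L) : (d% (f ∘ ι) y).range ≤ (C y₀)ᗮ :=
    hconst y ▸ (Submodule.le_orthogonal_orthogonal _).trans (Submodule.orthogonal_le inf_le_left)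
  refine ⟨.mk' (f (ι y₀)) (C y₀)ᗮ, AffineSubspace.mk'_nonempty _ _, ?_, fun y ↦
    sub_mem_orthogonal_of_range_mvfderiv_le (hg.mdifferentiable (by simp)) htangent y y₀⟩
  rw [AffineSubspace.direction_mk']
  exact finrank_orthogonal_relativeNormalSpace hp ((hf.contMDiff _).mdifferentiableAt (by simp))
    ((hι.contMDiff _).mdifferentiableAt (by simp)) (hf.injective_mvfderiv _)
    (hf.injective_mvfderiv_comp (hι.isImmersionAt y₀))

theorem proposition3 {n p l : ℕ}
    {M : Type*} [TopologicalSpace M] [ChartedSpace (EuclideanSpace ℝ (Fin n)) M]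
    [IsManifold (𝓡 n) ∞ M] [RiemannianBundle (fun x : M ↦ TangentSpace (𝓡 n) x)]
    [IsContMDiffRiemannianBundle (𝓡 n) ∞ (EuclideanSpace ℝ (Fin n))
      (fun x : M ↦ TangentSpace (𝓡 n) x)]
    {L : Type*} [TopologicalSpace L] [ConnectedSpace L]
    [ChartedSpace (EuclideanSpace ℝ (Fin l)) L] [IsManifold (𝓡 l) ∞ L]
    (f : M → EuclideanSpace ℝ (Fin (n + p))) (hf : IsIsometricImmersion (𝓡 n) f)
    (ι : L → M) (hι : IsImmersion (𝓡 l) (𝓡 n) ∞ ι)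
    (hgeo : IsTotallyGeodesic (𝓡 n) (𝓡 l) ι)
    (hadapted : ∀ y : L, IsAdapted (secondFundamentalForm f hf.contMDiff (ι y))
      ![tangentSubspace (𝓡 n) (𝓡 l) ι y, (tangentSubspace (𝓡 n) (𝓡 l) ι y)ᗮ]) :
    AdmitsReductionOfCodimension l (f ∘ ι) p := by
  simpa using proposition3_general (p := p) (by simp) hf hι hgeo fun y ↦ hadapted y 0
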